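/- Consider the binary deletion channel with deletion probability $d\in[0,1]$: each bit of an $n$-bit input word $X$ is deleted independently with probability $d$, and the receiver sees only the string $Y$ of surviving bits, in their original order. Its capacity, in bits per channel use, can be expressed in two standard ways (equal by Dobrushin's coding theorem): as the supremum $\mathrm{Cap}(d)$ of the achievable rates $R$, where $R$ is achievable if for every $\varepsilon>0$ and all sufficiently large $n$ there is a code of block length $n$ with at least $2^{nR}$ messages that recovers a uniformly random message with failure probability at most $\varepsilon$; and as the limit $\mathrm{Cap}(d)=\lim_{n\to\infty}\frac1n\sup I(X;Y)$, the supremum being over all distributions of the $n$-bit word $X$ and $I$ being mutual information in bits. For each $d \in [0,1]$ this supremum is a finite real number and this limit exists. Let $\varphi=(1+\sqrt5)/2$ be the golden ratio. Then, with $\mathrm{Cap}$ taken in either sense: 1. for every $d\in[1/2,1]$, unconditionally, $\mathrm{Cap}(d)\le(1-d)\log_2\varphi$; 2. if the function $\mathrm{Cap}$ is convex on $[0,1/2]$, then for every $d\in[0,1/2)$, $\mathrm{Cap}(d)\le 1-d\log_2(4/\varphi)$. -/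

import Mathlib

open Filter Topology

noncomputable section

namespace DeletionChannel

/-- The string received when the `n`-bit word `x` is sent and exactly the bits at the positions
in `S` survive: the surviving bits, in their original order. -/
def received {n : ℕ} (x : Fin n → Bool) (S : Finset (Fin n)) : List Bool :=
  ((List.finRange n).filter (fun i => i ∈ S)).map x

/-- The probability that exactly the positions in `S` survive, when each of the `n` bits is
deleted independently with probability `d`. -/
def survivalProb (d : ℝ) {n : ℕ} (S : Finset (Fin n)) : ℝ :=
  (1 - d) ^ S.card * d ^ (n - S.card)

/-- The transition law of `n` uses of the deletion channel: the probability that the string `y` is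
received when the word `x` is sent. -/
def transition (d : ℝ) {n : ℕ} (x : Fin n → Bool) (y : List Bool) : ℝ :=
  ∑ S : Finset (Fin n), if received x S = y then survivalProb d S else 0

/-! ### Capacity as the largest achievable rate -/

/-- The failure probability of a block code with `M` messages, block length `n`, encoder `enc` and
decoder `dec`, for a message that is uniformly distributed. -/
def failureProb (d : ℝ) {n M : ℕ} (enc : Fin M → Fin n → Bool) (dec : List Bool → Fin M) : ℝ :=
  (∑ m : Fin M, ∑ S : Finset (Fin n),
    if dec (received (enc m) S) = m then 0 else survivalProb d S) / M

/-- The rate `R` (in bits per channel use) is achievable: for each `ε > 0` there are, for all large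
block lengths `n`, codes with at least `2 ^ (n R)` messages and failure probability at
most `ε`. -/
def IsAchievableRate (d R : ℝ) : Prop :=
  ∀ ε : ℝ, 0 < ε → ∀ᶠ n : ℕ in atTop,
    ∃ (M : ℕ) (enc : Fin M → Fin n → Bool) (dec : List Bool → Fin M),
      (2 : ℝ) ^ ((n : ℝ) * R) ≤ (M : ℝ) ∧ failureProb d enc dec ≤ ε

/-- The (operational) capacity: the supremum of the achievable rates. -/
def capacity (d : ℝ) : ℝ := sSup {R : ℝ | IsAchievableRate d R}

/-! ### Capacity as the limit of the normalized maximal mutual information -/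

/-- All strings that can be received over `n` uses of the channel. -/
def outputs (n : ℕ) : Finset (List Bool) :=
  Finset.univ.image fun p : (Fin n → Bool) × Finset (Fin n) => received p.1 p.2

/-- The distribution of the received string `Y` when the input word has distribution `P`. -/
def outputProb (d : ℝ) {n : ℕ} (P : (Fin n → Bool) → ℝ) (y : List Bool) : ℝ :=
  ∑ x : Fin n → Bool, P x * transition d x y

/-- The mutual information `I(X; Y)`, in bits, between the input word `X` with distribution `P` and
the received string `Y`. -/
def mutualInfo (d : ℝ) {n : ℕ} (P : (Fin n → Bool) → ℝ) : ℝ :=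
  ∑ x : Fin n → Bool, ∑ y ∈ outputs n,
    P x * transition d x y * Real.logb 2 (transition d x y / outputProb d P y)

/-- The supremum of `I(X; Y)` over all distributions of the `n`-bit input word `X`. -/
def maxMutualInfo (d : ℝ) (n : ℕ) : ℝ :=
  sSup ((fun P => mutualInfo d P) '' stdSimplex ℝ (Fin n → Bool))

/-- The information capacity: the limit of `sup I(X; Y) / n`. -/
def informationCapacity (d : ℝ) : ℝ :=
  limUnder atTop fun n : ℕ => maxMutualInfo d n / n

end DeletionChannel

end

noncomputable section

namespace DeletionChannel

/-! ### The log-sum inequality -/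

/-- The summand `a log (a / b)` of a relative entropy, in nats. -/
def klTerm (a b : ℝ) : ℝ := a * Real.log (a / b)

@[simp] lemma klTerm_zero_left (b : ℝ) : klTerm 0 b = 0 := by simp [klTerm]

lemma klTerm_mul_mul {a b a' b' : ℝ} (h : b = 0 → a = 0) (h' : b' = 0 → a' = 0) :
    klTerm (a * a') (b * b') = a' * klTerm a b + a * klTerm a' b' := by
  unfold klTerm
  rcases eq_or_ne a 0 with rfl | ha
  · simp
  rcases eq_or_ne a' 0 with rfl | ha'
  · simp
  have hb : b ≠ 0 := fun hb => ha (h hb)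
  have hb' : b' ≠ 0 := fun hb => ha' (h' hb)
  rw [mul_div_mul_comm, Real.log_mul (by positivity) (by positivity)]
  ring

lemma klTerm_mul_left {c a b : ℝ} (hc : c ≠ 0) : klTerm (c * a) (c * b) = c * klTerm a b := by
  unfold klTerm
  rw [mul_div_mul_left _ _ hc]
  ring

lemma klTerm_anti_right {a b c : ℝ} (ha : 0 ≤ a) (hb : 0 < b) (hbc : b ≤ c) :
    klTerm a c ≤ klTerm a b := by
  unfold klTerm
  rcases ha.eq_or_lt with rfl | ha
  · simp
  have hc : 0 < c := hb.trans_le hbc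
  gcongr

/-- The tangent line inequality behind the log-sum inequality. -/
lemma klTerm_tangent {a b A B : ℝ} (ha : 0 ≤ a) (hb : 0 ≤ b) (h : b = 0 → a = 0) (hA : 0 < A)
    (hB : 0 < B) : a * Real.log (A / B) + a - b * (A / B) ≤ klTerm a b := by
  unfold klTerm
  rcases ha.eq_or_lt with rfl | ha
  · have : 0 ≤ b * (A / B) := by positivity
    simp only [zero_mul, zero_add, zero_div]
    linarith
  have hb : 0 < b := hb.lt_of_ne fun hb => ha.ne' (h hb.symm)
  have key := Real.log_le_sub_one_of_pos (x := (A / B) / (a / b)) (by positivity)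
  rw [Real.log_div (by positivity) (by positivity)] at key
  have h2 := mul_le_mul_of_nonneg_left key ha.le
  have h3 : a * (A / B / (a / b) - 1) = b * (A / B) - a := by field_simp
  linarith

/-- The log-sum inequality. -/
lemma klTerm_sum_le {ι : Type*} (s : Finset ι) (a b : ι → ℝ) (ha : ∀ i ∈ s, 0 ≤ a i)
    (hb : ∀ i ∈ s, 0 ≤ b i) (h : ∀ i ∈ s, b i = 0 → a i = 0) :
    klTerm (∑ i ∈ s, a i) (∑ i ∈ s, b i) ≤ ∑ i ∈ s, klTerm (a i) (b i) := by
  rcases (Finset.sum_nonneg ha).eq_or_lt with hA | hA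
  · have h0 : ∀ i ∈ s, a i = 0 := (Finset.sum_eq_zero_iff_of_nonneg ha).1 hA.symm
    rw [← hA, klTerm_zero_left]
    exact (Finset.sum_eq_zero fun i hi => by rw [h0 i hi, klTerm_zero_left]).ge
  have hB : 0 < ∑ i ∈ s, b i := by
    refine (Finset.sum_nonneg hb).lt_of_ne fun hB => hA.ne' ?_
    exact Finset.sum_eq_zero fun i hi =>
      h i hi ((Finset.sum_eq_zero_iff_of_nonneg hb).1 hB.symm i hi)
  refine le_trans (le_of_eq ?_)
    (Finset.sum_le_sum fun i hi => klTerm_tangent (ha i hi) (hb i hi) (h i hi) hA hB)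
  rw [Finset.sum_sub_distrib, Finset.sum_add_distrib, ← Finset.sum_mul, ← Finset.sum_mul, klTerm]
  field_simp
  ring

/-- Relative entropy with respect to a measure of mass at most one is nonnegative. -/
lemma sum_klTerm_nonneg {ι : Type*} (s : Finset ι) (a b : ι → ℝ) (ha : ∀ i ∈ s, 0 ≤ a i)
    (hb : ∀ i ∈ s, 0 ≤ b i) (h : ∀ i ∈ s, b i = 0 → a i = 0) (ha1 : ∑ i ∈ s, a i = 1)
    (hb1 : ∑ i ∈ s, b i ≤ 1) : 0 ≤ ∑ i ∈ s, klTerm (a i) (b i) := by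
  have h1 : 0 ≤ ∑ i ∈ s, (a i * Real.log (1 / 1) + a i - b i * (1 / 1)) := by
    simp only [div_one, Real.log_one, mul_zero, zero_add, mul_one, Finset.sum_sub_distrib]
    linarith
  exact h1.trans (Finset.sum_le_sum fun i hi =>
    klTerm_tangent (ha i hi) (hb i hi) (h i hi) one_pos one_pos)

/-- Convexity of relative entropy in its first argument. -/
lemma klTerm_convex {s t a a' b : ℝ} (hs : 0 ≤ s) (ht : 0 ≤ t) (hst : s + t = 1) (ha : 0 ≤ a)
    (ha' : 0 ≤ a') (hb : 0 < b) :
    klTerm (s * a + t * a') b ≤ s * klTerm a b + t * klTerm a' b := by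
  rcases hs.eq_or_lt with rfl | hs
  · obtain rfl : t = 1 := by linarith
    simp
  rcases ht.eq_or_lt with rfl | ht
  · obtain rfl : s = 1 := by linarith
    simp
  have key := klTerm_sum_le Finset.univ ![s * a, t * a'] ![s * b, t * b]
    (by intro i _; fin_cases i <;> simp <;> positivity)
    (by intro i _; fin_cases i <;> simp <;> positivity)
    (by intro i _; fin_cases i <;> simp [hs.ne', ht.ne', hb.ne'])
  simp only [Fin.sum_univ_two, Matrix.cons_val_zero, Matrix.cons_val_one,
    klTerm_mul_left hs.ne', klTerm_mul_left ht.ne', ← add_mul, hst, one_mul] at key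
  exact key

/-- The data processing inequality: merging atoms does not increase relative entropy. -/
lemma sum_klTerm_fiber_le {ι κ : Type*} [DecidableEq κ] (s : Finset ι) (t : Finset κ) (f : ι → κ)
    (hf : ∀ i ∈ s, f i ∈ t) (a b : ι → ℝ) (ha : ∀ i ∈ s, 0 ≤ a i)
    (hb : ∀ i ∈ s, 0 ≤ b i) (h : ∀ i ∈ s, b i = 0 → a i = 0) :
    ∑ k ∈ t, klTerm (∑ i ∈ s with f i = k, a i) (∑ i ∈ s with f i = k, b i) ≤
      ∑ i ∈ s, klTerm (a i) (b i) := by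
  rw [← Finset.sum_fiberwise_of_maps_to hf]
  refine Finset.sum_le_sum fun k _ => klTerm_sum_le _ _ _ ?_ ?_ ?_
  · exact fun i hi => ha i (Finset.mem_filter.1 hi).1
  · exact fun i hi => hb i (Finset.mem_filter.1 hi).1
  · exact fun i hi => h i (Finset.mem_filter.1 hi).1

/-! ### Strings of bounded length -/

/-- The binary strings of length at most `n`. -/
def lists : ℕ → Finset (List Bool)
  | 0 => {[]}
  | n + 1 => insert [] ((lists n).image (List.cons true) ∪ (lists n).image (List.cons false))

lemma mem_lists {n : ℕ} {y : List Bool} : y ∈ lists n ↔ y.length ≤ n := by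
  induction n generalizing y with
  | zero => simp [lists]
  | succ n ih =>
    rcases y with _ | ⟨a, y⟩
    · simp [lists]
    · cases a <;> simp [lists, ih]

lemma sum_lists_succ (n : ℕ) (f : List Bool → ℝ) :
    ∑ y ∈ lists (n + 1), f y =
      f [] + (∑ y ∈ lists n, f (true :: y) + ∑ y ∈ lists n, f (false :: y)) := by
  rw [lists, Finset.sum_insert (by simp), Finset.sum_union, Finset.sum_image, Finset.sum_image]
  · simp
  · simp
  · rw [Finset.disjoint_left]
    simp

lemma sum_lists_succ' (n : ℕ) (b : Bool) (f : List Bool → ℝ) :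
    ∑ y ∈ lists (n + 1), f y =
      f [] + (∑ y ∈ lists n, f (b :: y) + ∑ y ∈ lists n, f ((!b) :: y)) := by
  rw [sum_lists_succ]
  cases b
  · simp [add_comm]
  · simp

lemma sum_lists_zero (f : List Bool → ℝ) : ∑ y ∈ lists 0, f y = f [] := by simp [lists]

lemma lists_mono {m n : ℕ} (h : m ≤ n) : lists m ⊆ lists n := fun _ hy =>
  mem_lists.2 ((mem_lists.1 hy).trans h)

lemma card_lists_le (n : ℕ) : (lists n).card ≤ 2 ^ (n + 1) := by
  have h : ∀ n, ((lists n).card : ℝ) + 1 = 2 ^ (n + 1) := fun n => by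
    induction n with
    | zero => norm_num [lists]
    | succ n ih =>
      have h2 := sum_lists_succ n fun _ => 1
      simp only [Finset.sum_const, nsmul_eq_mul, mul_one] at h2
      rw [h2, pow_succ, ← ih]
      ring
  have h2 := h n
  have h3 : ((lists n).card : ℝ) ≤ ((2 ^ (n + 1) : ℕ) : ℝ) := by push_cast; linarith
  exact_mod_cast h3

/-! ### The law of the channel output, by recursion on the input -/

/-- `prepend a ν` is the law of `a :: Y` for `Y` of law `ν`. -/
def prepend (a : Bool) (ν : List Bool → ℝ) : List Bool → ℝ
  | [] => 0
  | c :: y => if c = a then ν y else 0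

@[simp] lemma prepend_nil (a : Bool) (ν : List Bool → ℝ) : prepend a ν [] = 0 := rfl

lemma prepend_cons (a c : Bool) (ν : List Bool → ℝ) (y : List Bool) :
    prepend a ν (c :: y) = if c = a then ν y else 0 := rfl

/-- The law of the string received when the string `x` is sent. -/
def law (d : ℝ) : List Bool → List Bool → ℝ
  | [], y => if y = [] then 1 else 0
  | a :: x, y => d * law d x y + (1 - d) * prepend a (law d x) y

lemma prepend_nonneg {a : Bool} {ν : List Bool → ℝ} (h : ∀ y, 0 ≤ ν y) (y : List Bool) :
    0 ≤ prepend a ν y := by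
  rcases y with _ | ⟨c, y⟩
  · exact le_rfl
  · rw [prepend_cons]
    split_ifs
    exacts [h y, le_rfl]

lemma law_nonneg {d : ℝ} (h0 : 0 ≤ d) (h1 : d ≤ 1) (x y : List Bool) : 0 ≤ law d x y := by
  induction x generalizing y with
  | nil => rw [law]; split_ifs <;> norm_num
  | cons a x ih =>
    have := prepend_nonneg (a := a) ih y
    have := ih y
    have : 0 ≤ 1 - d := by linarith
    rw [law]
    positivity

lemma law_eq_zero (d : ℝ) {x y : List Bool} (h : x.length < y.length) : law d x y = 0 := by
  induction x generalizing y with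
  | nil => rw [law, if_neg]; rintro rfl; simp at h
  | cons a x ih =>
    rcases y with _ | ⟨c, y⟩
    · simp at h
    · simp only [List.length_cons] at h
      rw [law, prepend_cons, ih (by simp; omega), ih (by omega)]
      simp

lemma sum_prepend (N : ℕ) (a : Bool) (ν : List Bool → ℝ) :
    ∑ y ∈ lists (N + 1), prepend a ν y = ∑ y ∈ lists N, ν y := by
  rw [sum_lists_succ' N a]
  simp [prepend_cons]

lemma sum_law (d : ℝ) (x : List Bool) {N : ℕ} (h : x.length ≤ N) :
    ∑ y ∈ lists N, law d x y = 1 := by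
  induction x generalizing N with
  | nil => simp [law, mem_lists]
  | cons a x ih =>
    rcases N with _ | N
    · simp at h
    · simp only [List.length_cons, add_le_add_iff_right] at h
      simp only [law]
      rw [Finset.sum_add_distrib, ← Finset.mul_sum, ← Finset.mul_sum, sum_prepend, ih h,
        ih (by omega)]
      ring

/-! ### The recursive law is the transition law -/

lemma sum_finset_fin_succ {n : ℕ} (f : Finset (Fin (n + 1)) → ℝ) :
    ∑ S, f S = ∑ T : Finset (Fin n), f (T.map (Fin.succEmb n)) +
      ∑ T : Finset (Fin n), f (insert 0 (T.map (Fin.succEmb n))) := by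
  have h0 : (0 : Fin (n + 1)) ∉ (Finset.univ : Finset (Fin n)).map (Fin.succEmb n) := by simp
  have h : (Finset.univ : Finset (Finset (Fin (n + 1)))) =
      (insert 0 ((Finset.univ : Finset (Fin n)).map (Fin.succEmb n))).powerset := by
    rw [← Finset.powerset_univ, Fin.univ_succ, Finset.cons_eq_insert]
    rfl
  have h2 : ((Finset.univ : Finset (Fin n)).map (Fin.succEmb n)).powerset =
      (Finset.univ : Finset (Finset (Fin n))).map
        (Finset.mapEmbedding (Fin.succEmb n)).toEmbedding := by
    ext S
    simp only [Finset.mem_powerset, Finset.mem_map, Finset.mem_univ, true_and,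
      Finset.subset_map_iff, Finset.subset_univ]
    simp [eq_comm]
  rw [h, Finset.sum_powerset_insert h0, h2, Finset.sum_map, Finset.sum_map]
  rfl

lemma received_map_succ {n : ℕ} (x : Fin (n + 1) → Bool) (T : Finset (Fin n)) :
    received x (T.map (Fin.succEmb n)) = received (fun i => x i.succ) T := by
  simp [received, List.finRange_succ, List.filter_map, Function.comp_def]

lemma received_insert_zero {n : ℕ} (x : Fin (n + 1) → Bool) (T : Finset (Fin n)) :
    received x (insert 0 (T.map (Fin.succEmb n))) = x 0 :: received (fun i => x i.succ) T := by
  simp [received, List.finRange_succ, List.filter_map, Function.comp_def]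

lemma survivalProb_map_succ (d : ℝ) {n : ℕ} (T : Finset (Fin n)) :
    survivalProb d (T.map (Fin.succEmb n)) = d * survivalProb d T := by
  have h : T.card ≤ n := by simpa using T.card_le_univ
  rw [survivalProb, survivalProb, Finset.card_map, Nat.succ_sub h, pow_succ]
  ring

lemma survivalProb_insert_zero (d : ℝ) {n : ℕ} (T : Finset (Fin n)) :
    survivalProb d (insert 0 (T.map (Fin.succEmb n))) = (1 - d) * survivalProb d T := by
  rw [survivalProb, survivalProb, Finset.card_insert_of_notMem (by simp), Finset.card_map,
    Nat.add_sub_add_right, pow_succ]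
  ring

/-- The expectation of a function of the received string. -/
lemma sum_survivalProb (d : ℝ) {n N : ℕ} (x : Fin n → Bool) (hN : n ≤ N) (f : List Bool → ℝ) :
    ∑ S, survivalProb d S * f (received x S) =
      ∑ y ∈ lists N, law d (List.ofFn x) y * f y := by
  induction n generalizing N f with
  | zero =>
    have : ∀ y ∈ lists N, law d (List.ofFn x) y * f y = if [] = y then f [] else 0 := by
      intro y _
      simp only [List.ofFn_zero, law, eq_comm (a := ([] : List Bool))]
      split_ifs with h <;> simp [h]
    rw [Finset.sum_congr rfl this, Finset.sum_ite_eq]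
    rw [Fintype.sum_unique, Finset.eq_empty_of_isEmpty default]
    simp [mem_lists, survivalProb, received]
  | succ n ih =>
    obtain ⟨N, rfl⟩ : ∃ M, N = M + 1 := ⟨N - 1, by omega⟩
    rw [sum_finset_fin_succ]
    simp only [received_map_succ, received_insert_zero, survivalProb_map_succ,
      survivalProb_insert_zero, mul_assoc, ← Finset.mul_sum]
    rw [ih (fun i => x i.succ) (by omega : n ≤ N + 1),
      ih (fun i => x i.succ) (by omega : n ≤ N) fun y => f (x 0 :: y), List.ofFn_succ]
    simp only [law, add_mul, Finset.sum_add_distrib, mul_assoc, ← Finset.mul_sum]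
    congr 2
    rw [sum_lists_succ' N (x 0)]
    simp [prepend_cons]

lemma transition_eq_law (d : ℝ) {n : ℕ} (x : Fin n → Bool) (y : List Bool) :
    transition d x y = law d (List.ofFn x) y := by
  have h := sum_survivalProb d x le_rfl fun z => if z = y then 1 else 0
  simp only [mul_ite, mul_one, mul_zero, Finset.sum_ite_eq'] at h
  rw [transition, h]
  split_ifs with h2
  · rfl
  · exact (law_eq_zero d (by simpa [mem_lists] using h2)).symm

lemma outputs_subset_lists (n : ℕ) : outputs n ⊆ lists n := by
  intro y hy
  obtain ⟨p, -, rfl⟩ := Finset.mem_image.1 hy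
  rw [mem_lists, received, List.length_map]
  exact (List.length_filter_le _ _).trans (by simp)

lemma transition_eq_zero (d : ℝ) {n : ℕ} (x : Fin n → Bool) {y : List Bool}
    (hy : y ∉ outputs n) : transition d x y = 0 :=
  Finset.sum_eq_zero fun S _ => if_neg fun h =>
    hy (Finset.mem_image.2 ⟨(x, S), Finset.mem_univ _, h⟩)

/-- The law of the output for a concatenation of two inputs. -/
lemma law_append (d : ℝ) (x x' y : List Bool) {N N' : ℕ} (hN : x.length ≤ N)
    (hN' : x'.length ≤ N') :
    law d (x ++ x') y =
      ∑ p ∈ lists N ×ˢ lists N' with p.1 ++ p.2 = y, law d x p.1 * law d x' p.2 := by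
  rw [Finset.sum_filter, Finset.sum_product]
  induction x generalizing y N with
  | nil =>
    simp only [law, ite_mul, one_mul, zero_mul, List.nil_append]
    rw [Finset.sum_eq_single []]
    · simp only [List.nil_append, if_true, Finset.sum_ite_eq', mem_lists]
      split_ifs with h
      · rfl
      · exact law_eq_zero d (by omega)
    · intro z _ hz
      simp [hz]
    · simp [mem_lists]
  | cons a x ih =>
    obtain ⟨N, rfl⟩ : ∃ M, N = M + 1 := ⟨N - 1, by simp at hN; omega⟩
    simp only [List.length_cons, add_le_add_iff_right] at hN
    have e : ∀ z z' : List Bool, (if z ++ z' = y then law d (a :: x) z * law d x' z' else 0) =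
        d * (if z ++ z' = y then law d x z * law d x' z' else 0) +
        (1 - d) * (if z ++ z' = y then prepend a (law d x) z * law d x' z' else 0) := by
      intro z z'
      rw [law]
      split_ifs <;> ring
    simp only [e, Finset.sum_add_distrib, ← Finset.mul_sum]
    rw [← ih y (by omega : x.length ≤ N + 1), List.cons_append, law]
    congr 2
    rw [sum_lists_succ' N a]
    rcases y with _ | ⟨c, y⟩
    · simp
    · simp only [prepend_nil, prepend_cons, zero_mul, ite_self, Finset.sum_const_zero, zero_add,
        List.cons_append, List.cons.injEq, if_true, Bool.not_eq_self, if_false, add_zero]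
      rw [ih y hN]
      split_ifs with h
      · simp [h]
      · simp [Ne.symm h]

/-! ### Mutual information of a finite channel -/

section FiniteChannel

variable {A A' B B' C : Type*} [Fintype A] [Fintype A']

/-- The output law of the channel `W` for the input law `P`. -/
def outLaw (P : A → ℝ) (W : A → B → ℝ) (b : B) : ℝ := ∑ a, P a * W a b

/-- The mutual information, in nats, for the channel `W` and the input law `P`. -/
def info (P : A → ℝ) (W : A → B → ℝ) (s : Finset B) : ℝ :=
  ∑ a, P a * ∑ b ∈ s, klTerm (W a b) (outLaw P W b)

variable {P : A → ℝ} {W : A → B → ℝ} {s : Finset B}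

lemma outLaw_nonneg (hP : ∀ a, 0 ≤ P a) (hW : ∀ a b, 0 ≤ W a b) (b : B) : 0 ≤ outLaw P W b :=
  Finset.sum_nonneg fun a _ => mul_nonneg (hP a) (hW a b)

lemma eq_zero_of_outLaw_eq_zero (hP : ∀ a, 0 ≤ P a) (hW : ∀ a b, 0 ≤ W a b) {a : A}
    (ha : P a ≠ 0) {b : B} (hb : outLaw P W b = 0) : W a b = 0 := by
  have := (Finset.sum_eq_zero_iff_of_nonneg fun a _ => mul_nonneg (hP a) (hW a b)).1 hb a
    (Finset.mem_univ a)
  exact (mul_eq_zero.1 this).resolve_left ha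

lemma sum_outLaw (hP1 : ∑ a, P a = 1) (hW1 : ∀ a, ∑ b ∈ s, W a b = 1) :
    ∑ b ∈ s, outLaw P W b = 1 := by
  simp only [outLaw]
  rw [Finset.sum_comm]
  simp [← Finset.mul_sum, hW1, hP1]

lemma info_nonneg (hP : ∀ a, 0 ≤ P a) (hW : ∀ a b, 0 ≤ W a b) (hP1 : ∑ a, P a = 1)
    (hW1 : ∀ a, ∑ b ∈ s, W a b = 1) : 0 ≤ info P W s := by
  refine Finset.sum_nonneg fun a _ => ?_
  rcases eq_or_ne (P a) 0 with h | h
  · simp [h]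
  · exact mul_nonneg (hP a) (sum_klTerm_nonneg _ _ _ (fun b _ => hW a b)
      (fun b _ => outLaw_nonneg hP hW b) (fun b _ => eq_zero_of_outLaw_eq_zero hP hW h) (hW1 a)
      (sum_outLaw hP1 hW1).le)

/-- Mutual information is at most the mean divergence of the output from any fixed law. -/
lemma info_le (hP : ∀ a, 0 ≤ P a) (hW : ∀ a b, 0 ≤ W a b) (hP1 : ∑ a, P a = 1)
    (hW1 : ∀ a, ∑ b ∈ s, W a b = 1) (Q : B → ℝ) (hQ : ∀ b ∈ s, 0 ≤ Q b)
    (hQ1 : ∑ b ∈ s, Q b ≤ 1) (hPQ : ∀ a, P a ≠ 0 → ∀ b ∈ s, Q b = 0 → W a b = 0) :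
    info P W s ≤ ∑ a, P a * ∑ b ∈ s, klTerm (W a b) (Q b) := by
  have hPQ' : ∀ b ∈ s, Q b = 0 → outLaw P W b = 0 := fun b hb h =>
    Finset.sum_eq_zero fun a _ => by
      rcases eq_or_ne (P a) 0 with ha | ha
      · simp [ha]
      · simp [hPQ a ha b hb h]
  have key : 0 ≤ ∑ b ∈ s, klTerm (outLaw P W b) (Q b) :=
    sum_klTerm_nonneg _ _ _ (fun b _ => outLaw_nonneg hP hW b) hQ hPQ' (sum_outLaw hP1 hW1) hQ1
  suffices h : ∑ a, P a * ∑ b ∈ s, klTerm (W a b) (Q b) =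
      info P W s + ∑ b ∈ s, klTerm (outLaw P W b) (Q b) by linarith
  have h2 : ∑ b ∈ s, klTerm (outLaw P W b) (Q b) =
      ∑ a, P a * ∑ b ∈ s, W a b * Real.log (outLaw P W b / Q b) := by
    simp only [Finset.mul_sum]
    rw [Finset.sum_comm]
    refine Finset.sum_congr rfl fun b _ => ?_
    rw [klTerm, outLaw, Finset.sum_mul]
    exact Finset.sum_congr rfl fun a _ => mul_assoc _ _ _
  rw [h2, info, ← Finset.sum_add_distrib]
  refine Finset.sum_congr rfl fun a _ => ?_
  rw [← mul_add, ← Finset.sum_add_distrib]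
  rcases eq_or_ne (P a) 0 with ha | ha
  · simp [ha]
  congr 1
  refine Finset.sum_congr rfl fun b hb => ?_
  rcases eq_or_ne (W a b) 0 with hw | hw
  · simp [hw]
  have ho : outLaw P W b ≠ 0 := fun h => hw (eq_zero_of_outLaw_eq_zero hP hW ha h)
  have hq : Q b ≠ 0 := fun h => ho (hPQ' b hb h)
  rw [klTerm, klTerm, ← mul_add, ← Real.log_mul (by positivity) (by positivity)]
  congr 2
  field_simp

/-- Subadditivity of mutual information for a product channel whose outputs are merged. -/
lemma info_prod_le [DecidableEq C] {P : A × A' → ℝ} {W' : A' → B' → ℝ} {s' : Finset B'}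
    (f : B × B' → C) (t : Finset C) (hf : ∀ p ∈ s ×ˢ s', f p ∈ t)
    (hP : ∀ a, 0 ≤ P a) (hP1 : ∑ a, P a = 1)
    (hW : ∀ a b, 0 ≤ W a b) (hW1 : ∀ a, ∑ b ∈ s, W a b = 1)
    (hW' : ∀ a b, 0 ≤ W' a b) (hW1' : ∀ a, ∑ b ∈ s', W' a b = 1) :
    info P (fun (a : A × A') c => ∑ p ∈ s ×ˢ s' with f p = c, W a.1 p.1 * W' a.2 p.2) t ≤
      info (fun a => ∑ a', P (a, a')) W s + info (fun a' => ∑ a, P (a, a')) W' s' := by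
  set P₁ : A → ℝ := fun a => ∑ a', P (a, a') with hP₁
  set P₂ : A' → ℝ := fun a' => ∑ a, P (a, a') with hP₂
  have n₁ : ∀ a, 0 ≤ P₁ a := fun a => Finset.sum_nonneg fun a' _ => hP _
  have n₂ : ∀ a, 0 ≤ P₂ a := fun a => Finset.sum_nonneg fun a' _ => hP _
  have t₁ : ∑ a, P₁ a = 1 := by rw [← hP1, Fintype.sum_prod_type]
  have t₂ : ∑ a, P₂ a = 1 := by rw [← hP1, Fintype.sum_prod_type_right]
  have z₁ : ∀ a, P a ≠ 0 → P₁ a.1 ≠ 0 := fun a ha h => ha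
    ((Finset.sum_eq_zero_iff_of_nonneg fun _ _ => hP _).1 h a.2 (Finset.mem_univ _))
  have z₂ : ∀ a, P a ≠ 0 → P₂ a.2 ≠ 0 := fun a ha h => ha
    ((Finset.sum_eq_zero_iff_of_nonneg fun _ _ => hP _).1 h a.1 (Finset.mem_univ _))
  set o₁ := outLaw P₁ W
  set o₂ := outLaw P₂ W'
  have ho₁ : ∀ b, 0 ≤ o₁ b := outLaw_nonneg n₁ hW
  have ho₂ : ∀ b, 0 ≤ o₂ b := outLaw_nonneg n₂ hW'
  have ac : ∀ a : A × A', P a ≠ 0 → ∀ p : B × B', o₁ p.1 * o₂ p.2 = 0 → W a.1 p.1 * W' a.2 p.2 = 0 := by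
    intro a ha p hp
    rcases mul_eq_zero.1 hp with h | h
    · rw [eq_zero_of_outLaw_eq_zero n₁ hW (z₁ a ha) h, zero_mul]
    · rw [eq_zero_of_outLaw_eq_zero n₂ hW' (z₂ a ha) h, mul_zero]
  have e1 : ∀ a : A × A', ∑ c ∈ t, ∑ p ∈ s ×ˢ s' with f p = c, W a.1 p.1 * W' a.2 p.2 = (1 : ℝ) := by
    intro a
    rw [Finset.sum_fiberwise_of_maps_to hf, Finset.sum_product]
    simp [← Finset.mul_sum, hW1, hW1']
  have e2 : ∑ c ∈ t, ∑ p ∈ s ×ˢ s' with f p = c, o₁ p.1 * o₂ p.2 = (1 : ℝ) := by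
    rw [Finset.sum_fiberwise_of_maps_to hf, Finset.sum_product]
    simp [← Finset.mul_sum, o₁, o₂, sum_outLaw t₁ hW1, sum_outLaw t₂ hW1']
  refine (info_le hP (fun a c => Finset.sum_nonneg fun p _ => mul_nonneg (hW _ _) (hW' _ _)) hP1
    e1 (fun c => ∑ p ∈ s ×ˢ s' with f p = c, o₁ p.1 * o₂ p.2)
    (fun c _ => Finset.sum_nonneg fun p _ => mul_nonneg (ho₁ _) (ho₂ _)) e2.le ?_).trans ?_
  · intro a ha c _ hc
    refine Finset.sum_eq_zero fun p hp => ac a ha p ?_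
    exact (Finset.sum_eq_zero_iff_of_nonneg fun p _ => mul_nonneg (ho₁ _) (ho₂ _)).1 hc p hp
  have bound : ∀ a : A × A', P a * ∑ c ∈ t, klTerm (∑ p ∈ s ×ˢ s' with f p = c, W a.1 p.1 * W' a.2 p.2)
      (∑ p ∈ s ×ˢ s' with f p = c, o₁ p.1 * o₂ p.2) ≤
      P a * ∑ b ∈ s, klTerm (W a.1 b) (o₁ b) + P a * ∑ b ∈ s', klTerm (W' a.2 b) (o₂ b) := by
    intro a
    rcases eq_or_ne (P a) 0 with ha | ha
    · simp [ha]
    rw [← mul_add]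
    refine mul_le_mul_of_nonneg_left ?_ (hP a)
    refine (sum_klTerm_fiber_le _ t f hf _ _ (fun p _ => mul_nonneg (hW _ _) (hW' _ _))
      (fun p _ => mul_nonneg (ho₁ _) (ho₂ _)) fun p _ => ac a ha p).trans (le_of_eq ?_)
    have : ∀ p : B × B', klTerm (W a.1 p.1 * W' a.2 p.2) (o₁ p.1 * o₂ p.2) =
        klTerm (W a.1 p.1) (o₁ p.1) * W' a.2 p.2 + W a.1 p.1 * klTerm (W' a.2 p.2) (o₂ p.2) := by
      intro p
      rw [klTerm_mul_mul (eq_zero_of_outLaw_eq_zero n₁ hW (z₁ a ha))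
        (eq_zero_of_outLaw_eq_zero n₂ hW' (z₂ a ha))]
      ring
    simp only [this, Finset.sum_add_distrib]
    rw [Finset.sum_product, Finset.sum_product]
    simp only [← Finset.mul_sum, ← Finset.sum_mul, hW1, hW1', mul_one, one_mul]
  refine (Finset.sum_le_sum fun a _ => bound a).trans (le_of_eq ?_)
  rw [Finset.sum_add_distrib, Fintype.sum_prod_type, Fintype.sum_prod_type_right]
  simp only [← Finset.sum_mul]
  rfl

end FiniteChannel

/-! ### A law for the run lengths -/

lemma sum_centralBinom_hasDerivAt (n : ℕ) (t : ℝ) :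
    ∃ D, HasDerivAt (fun t : ℝ => ∑ r ∈ Finset.range (n + 1), (r.centralBinom : ℝ) * (t / 4) ^ r)
      D t ∧ (1 - t) * D =
        (∑ r ∈ Finset.range (n + 1), (r.centralBinom : ℝ) * (t / 4) ^ r) / 2 -
          (n + 1 / 2) * (n.centralBinom * (t / 4) ^ n) := by
  induction n with
  | zero => exact ⟨0, by simpa using hasDerivAt_const t (1 : ℝ), by simp⟩
  | succ n ih =>
    obtain ⟨D, hD, h⟩ := ih
    have h1 : HasDerivAt (fun t : ℝ => ((n + 1).centralBinom : ℝ) * (t / 4) ^ (n + 1))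
        ((n + 1).centralBinom * (((n + 1 : ℕ) : ℝ) * (t / 4) ^ n * (1 / 4))) t := by
      have := (((hasDerivAt_id t).div_const 4).pow (n + 1)).const_mul ((n + 1).centralBinom : ℝ)
      simpa using this
    refine ⟨_, (hD.add h1).congr_of_eventuallyEq (.of_forall fun t => ?_), ?_⟩
    · exact Finset.sum_range_succ _ _
    · have h2 : ((n + 1 : ℕ) : ℝ) * (n + 1).centralBinom = 2 * (2 * n + 1) * n.centralBinom := by
        exact_mod_cast Nat.succ_mul_centralBinom_succ n
      rw [Finset.sum_range_succ, mul_add, h, pow_succ]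
      push_cast at h2 ⊢
      linear_combination (t / 4) ^ n / 4 * h2

/-- The partial sums of the generating function of the central binomial coefficients. -/
lemma sq_sum_centralBinom_mul_le (n : ℕ) {t : ℝ} (h0 : 0 ≤ t) :
    (∑ r ∈ Finset.range (n + 1), (r.centralBinom : ℝ) * (t / 4) ^ r) ^ 2 * (1 - t) ≤ 1 := by
  set S : ℝ → ℝ := fun t => ∑ r ∈ Finset.range (n + 1), (r.centralBinom : ℝ) * (t / 4) ^ r with hS
  choose D hD h using sum_centralBinom_hasDerivAt n
  have hder : ∀ t, HasDerivAt (fun t => S t ^ 2 * (1 - t))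
      (2 * S t * D t * (1 - t) + S t ^ 2 * (-1)) t := by
    intro t
    exact (((hD t).pow 2).mul ((hasDerivAt_id t).const_sub 1)).congr_deriv (by simp [hS])
  have hanti : AntitoneOn (fun t => S t ^ 2 * (1 - t)) (Set.Ici 0) := by
    refine antitoneOn_of_deriv_nonpos (convex_Ici 0)
      (fun t _ => (hder t).continuousAt.continuousWithinAt)
      (fun t _ => (hder t).differentiableAt.differentiableWithinAt) fun t ht => ?_
    rw [interior_Ici, Set.mem_Ioi] at ht
    have hSt : 0 ≤ S t := Finset.sum_nonneg fun r _ => by positivity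
    have hp : 0 ≤ S t * ((n + 1 / 2) * (n.centralBinom * (t / 4) ^ n)) := by positivity
    have h' : (1 - t) * D t = S t / 2 - (n + 1 / 2) * (n.centralBinom * (t / 4) ^ n) := h t
    rw [(hder t).deriv]
    have : 2 * S t * D t * (1 - t) + S t ^ 2 * (-1) =
        -2 * (S t * ((n + 1 / 2) * (n.centralBinom * (t / 4) ^ n))) := by
      linear_combination 2 * S t * h'
    linarith
  have h2 := hanti (Set.mem_Ici.2 le_rfl) (Set.mem_Ici.2 h0) h0
  have h3 : S 0 = 1 := by
    simp only [hS]
    rw [Finset.sum_range_succ']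
    simp
  simpa [h3] using h2

/-- The weight `√(1 - q) C(2r, r) (q / 4) ^ r` of a run of length `r`, for `q = √(1 - q) = 1 / φ`. -/
def runWeight (r : ℕ) : ℝ :=
  Real.goldenRatio⁻¹ * (r.centralBinom * (Real.goldenRatio⁻¹ / 4) ^ r)

lemma runWeight_pos (r : ℕ) : 0 < runWeight r := by
  have := Real.goldenRatio_pos
  have : (0 : ℝ) < r.centralBinom := by exact_mod_cast r.centralBinom_pos
  unfold runWeight
  positivity

lemma sum_runWeight_range_le (n : ℕ) : ∑ r ∈ Finset.range (n + 1), runWeight r ≤ 1 := by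
  have hφ := Real.goldenRatio_pos
  have hq : 1 - Real.goldenRatio⁻¹ = Real.goldenRatio⁻¹ ^ 2 := by
    linear_combination Real.goldenRatio⁻¹ ^ 2 * Real.goldenRatio_sq -
      (Real.goldenRatio * Real.goldenRatio⁻¹ + 1 - Real.goldenRatio⁻¹) *
        mul_inv_cancel₀ hφ.ne'
  have h := sq_sum_centralBinom_mul_le n (inv_nonneg.2 hφ.le)
  rw [hq, ← mul_pow, mul_comm, Finset.mul_sum] at h
  exact (sq_le_one_iff₀ (Finset.sum_nonneg fun r _ => (runWeight_pos r).le)).1 h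

lemma sum_runWeight_le (s : Finset ℕ) : ∑ r ∈ s, runWeight r ≤ 1 :=
  (Finset.sum_le_sum_of_subset_of_nonneg
    (fun _ hr => Finset.mem_range_succ_iff.2 (Finset.le_sup (f := id) hr))
    fun r _ _ => (runWeight_pos r).le).trans (sum_runWeight_range_le (s.sup id))

/-! ### Fair binomial laws -/

/-- The weights of the binomial law with `k` fair trials. -/
def fairBinom (k r : ℕ) : ℝ := k.choose r / 2 ^ k

lemma fairBinom_nonneg (k r : ℕ) : 0 ≤ fairBinom k r := by
  unfold fairBinom
  positivity

lemma sum_fairBinom (k : ℕ) : ∑ r ∈ Finset.range (k + 1), fairBinom k r = 1 := by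
  simp only [fairBinom]
  rw [← Finset.sum_div, div_eq_one_iff_eq (by positivity)]
  exact_mod_cast Nat.sum_range_choose k

lemma fairBinom_eq_zero {k r : ℕ} (h : k < r) : fairBinom k r = 0 := by
  simp [fairBinom, Nat.choose_eq_zero_of_lt h]

lemma fairBinom_succ_zero (k : ℕ) : fairBinom (k + 1) 0 = fairBinom k 0 / 2 := by
  simp [fairBinom, pow_succ]
  ring

lemma fairBinom_succ_succ (k r : ℕ) :
    fairBinom (k + 1) (r + 1) = (fairBinom k (r + 1) + fairBinom k r) / 2 := by
  simp only [fairBinom, Nat.choose_succ_succ, pow_succ]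
  push_cast
  field_simp
  ring

lemma sum_fairBinom_reflect (k : ℕ) (f : ℕ → ℝ) :
    ∑ r ∈ Finset.range (k + 1), fairBinom k r * f (k - r) =
      ∑ r ∈ Finset.range (k + 1), fairBinom k r * f r := by
  rw [← Finset.sum_range_reflect]
  refine Finset.sum_congr rfl fun r hr => ?_
  have hr : r ≤ k := Finset.mem_range_succ_iff.1 hr
  rw [show k + 1 - 1 - r = k - r by omega, Nat.sub_sub_self hr, fairBinom, fairBinom,
    Nat.choose_symm hr]

lemma sum_fairBinom_mul_self (k : ℕ) :
    ∑ r ∈ Finset.range (k + 1), fairBinom k r * (r : ℝ) = k / 2 := by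
  have h := sum_fairBinom_reflect k fun r => (r : ℝ)
  have h2 : ∑ r ∈ Finset.range (k + 1), fairBinom k r * ((k - r : ℕ) : ℝ) =
      ∑ r ∈ Finset.range (k + 1), (fairBinom k r * k - fairBinom k r * r) :=
    Finset.sum_congr rfl fun r hr => by
      rw [Nat.cast_sub (Finset.mem_range_succ_iff.1 hr)]
      ring
  rw [h2, Finset.sum_sub_distrib, ← Finset.sum_mul, sum_fairBinom] at h
  linarith

/-- Jensen's inequality for the log-convex function `Γ`. -/
lemma log_factorial_le_sum_fairBinom (k : ℕ) :
    Real.log (k.factorial : ℝ) ≤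
      ∑ r ∈ Finset.range (k + 1), fairBinom k r * Real.log ((2 * r).factorial : ℝ) := by
  have h := Real.convexOn_log_Gamma.map_sum_le (t := Finset.range (k + 1)) (w := fairBinom k)
    (p := fun r => ((2 * r : ℕ) : ℝ) + 1) (fun r _ => fairBinom_nonneg k r) (sum_fairBinom k)
    (fun r _ => Set.mem_Ioi.2 (by positivity))
  simp only [smul_eq_mul, Function.comp_apply, Real.Gamma_nat_eq_factorial] at h
  have h2 : ∑ r ∈ Finset.range (k + 1), fairBinom k r * (((2 * r : ℕ) : ℝ) + 1) = k + 1 := by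
    simp only [mul_add, Finset.sum_add_distrib, mul_one, sum_fairBinom]
    push_cast
    simp only [mul_left_comm _ (2 : ℝ), ← Finset.mul_sum, sum_fairBinom_mul_self]
    ring
  rwa [h2, Real.Gamma_nat_eq_factorial] at h

/-- The divergence of a fair binomial law from the run length law is at most linear. -/
lemma sum_klTerm_fairBinom_le (k : ℕ) :
    ∑ r ∈ Finset.range (k + 1), klTerm (fairBinom k r) (runWeight r) ≤
      Real.log Real.goldenRatio * (k / 2 + 1) := by
  set ℓ := Real.log Real.goldenRatio with hℓ
  have hφ := Real.goldenRatio_pos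
  have hf : ∀ j : ℕ, (j.factorial : ℝ) ≠ 0 := fun j => by exact_mod_cast j.factorial_ne_zero
  have h4 : Real.log 4 = 2 * Real.log 2 := by
    rw [show (4 : ℝ) = 2 ^ 2 by norm_num, Real.log_pow]
    norm_num
  have term : ∀ r ∈ Finset.range (k + 1), klTerm (fairBinom k r) (runWeight r) =
      fairBinom k r * (Real.log k.factorial - k * Real.log 2 + ℓ)
      + fairBinom k r * Real.log r.factorial
      - fairBinom k r * Real.log (k - r).factorial
      - fairBinom k r * Real.log (2 * r).factorial
      + fairBinom k r * r * (2 * Real.log 2 + ℓ) := by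
    intro r hr
    have hr : r ≤ k := Finset.mem_range_succ_iff.1 hr
    have e1 : fairBinom k r = k.factorial / (r.factorial * (k - r).factorial) / 2 ^ k := by
      rw [fairBinom, Nat.cast_choose ℝ hr]
    have e2 : runWeight r = Real.goldenRatio⁻¹ *
        ((2 * r).factorial / (r.factorial * r.factorial) * (Real.goldenRatio⁻¹ / 4) ^ r) := by
      rw [runWeight, Nat.centralBinom_eq_two_mul_choose, Nat.cast_choose ℝ (by omega),
        show 2 * r - r = r by omega]
    have := hf k; have := hf r; have := hf (k - r); have := hf (2 * r)
    have l1 : Real.log (fairBinom k r) = Real.log k.factorial -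
        (Real.log r.factorial + Real.log (k - r).factorial) - k * Real.log 2 := by
      rw [e1, Real.log_div (by positivity) (by positivity), Real.log_div (by positivity)
        (by positivity), Real.log_mul (by positivity) (by positivity), Real.log_pow]
    have l2 : Real.log (runWeight r) = -ℓ + (Real.log (2 * r).factorial -
        (Real.log r.factorial + Real.log r.factorial) + r * (-ℓ - 2 * Real.log 2)) := by
      rw [e2, Real.log_mul (by positivity) (by positivity), Real.log_mul (by positivity)
        (by positivity), Real.log_div (by positivity) (by positivity), Real.log_mul (by positivity)
        (by positivity), Real.log_pow, Real.log_div (by positivity) (by positivity), Real.log_inv,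
        h4]
    have hpos : fairBinom k r ≠ 0 := by rw [e1]; positivity
    rw [klTerm, Real.log_div hpos (runWeight_pos r).ne', l1, l2]
    ring
  rw [Finset.sum_congr rfl term]
  simp only [Finset.sum_add_distrib, Finset.sum_sub_distrib, ← Finset.sum_mul, sum_fairBinom,
    sum_fairBinom_mul_self]
  rw [sum_fairBinom_reflect k fun r => Real.log r.factorial]
  have := log_factorial_le_sum_fairBinom k
  linarith

/-! ### The reference law on strings -/

/-- The product of the weights of the runs of a string, when a run of the bit `b` is in progress
and has length `r` so far. -/
def runLaw : Bool → ℕ → List Bool → ℝ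
  | _, r, [] => runWeight r
  | b, r, a :: y => if a = b then runLaw b (r + 1) y else runWeight r * runLaw a 0 y

lemma runLaw_pos (b : Bool) (r : ℕ) (y : List Bool) : 0 < runLaw b r y := by
  induction y generalizing b r with
  | nil => exact runWeight_pos r
  | cons a y ih =>
    rw [runLaw]
    split_ifs
    exacts [ih _ _, mul_pos (runWeight_pos r) (ih _ _)]

lemma sum_runLaw_le (N : ℕ) (b : Bool) (r : ℕ) :
    ∑ y ∈ lists N, runLaw b r y ≤ (N + 1) * ∑ j ∈ Finset.Icc r (r + N), runWeight j := by
  induction N generalizing b r with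
  | zero => simp [sum_lists_zero, runLaw]
  | succ N ih =>
    rw [sum_lists_succ' N b]
    simp only [runLaw, if_true, Bool.not_eq_self, if_false, ← Finset.mul_sum]
    have h1 := ih b (r + 1)
    have h2 := ih (!b) 0
    have h3 : ∑ y ∈ lists N, runLaw (!b) 0 y ≤ N + 1 :=
      h2.trans (mul_le_of_le_one_right (by positivity) (sum_runWeight_le _))
    have h4 := mul_le_mul_of_nonneg_left h3 (runWeight_pos r).le
    have h5 : ∑ j ∈ Finset.Icc r (r + (N + 1)), runWeight j =
        runWeight r + ∑ j ∈ Finset.Icc (r + 1) (r + 1 + N), runWeight j := by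
      rw [← Finset.insert_Icc_succ_left_eq_Icc (by omega), Finset.sum_insert (by simp)]
      rw [show r + (N + 1) = r + 1 + N by omega]
      rfl
    have h6 : 0 ≤ ∑ j ∈ Finset.Icc (r + 1) (r + 1 + N), runWeight j :=
      Finset.sum_nonneg fun j _ => (runWeight_pos j).le
    rw [h5]
    push_cast
    linarith

/-! ### Strings that start with a random run -/

/-- `afterRun b w ν` is the law of `b ^ R ++ Y` for independent `R` of law `w` and `Y` of
law `ν`. -/
def afterRun (b : Bool) : (ℕ → ℝ) → (List Bool → ℝ) → List Bool → ℝ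
  | w, ν, [] => w 0 * ν []
  | w, ν, a :: y => w 0 * ν (a :: y) + if a = b then afterRun b (fun r => w (r + 1)) ν y else 0

lemma afterRun_nonneg {b : Bool} {w : ℕ → ℝ} {ν : List Bool → ℝ} (hw : ∀ r, 0 ≤ w r)
    (hν : ∀ y, 0 ≤ ν y) (y : List Bool) : 0 ≤ afterRun b w ν y := by
  induction y generalizing w with
  | nil => exact mul_nonneg (hw 0) (hν _)
  | cons a y ih =>
    rw [afterRun]
    have h1 := mul_nonneg (hw 0) (hν (a :: y))
    have h2 := ih (w := fun r => w (r + 1)) fun r => hw _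
    split_ifs <;> linarith

lemma afterRun_zero (b : Bool) (ν : List Bool → ℝ) (y : List Bool) :
    afterRun b (fun _ => 0) ν y = 0 := by
  induction y with
  | nil => simp [afterRun]
  | cons a y ih => simp [afterRun, ih]

lemma afterRun_add_right (b : Bool) (w : ℕ → ℝ) (s t : ℝ) (ν ν' : List Bool → ℝ) (y : List Bool) :
    afterRun b w (fun y => s * ν y + t * ν' y) y =
      s * afterRun b w ν y + t * afterRun b w ν' y := by
  induction y generalizing w with
  | nil => simp only [afterRun]; ring
  | cons a y ih =>
    simp only [afterRun, ih]
    split_ifs <;> ring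

lemma afterRun_add_left (b : Bool) (w w' : ℕ → ℝ) (s t : ℝ) (ν : List Bool → ℝ) (y : List Bool) :
    afterRun b (fun r => s * w r + t * w' r) ν y =
      s * afterRun b w ν y + t * afterRun b w' ν y := by
  induction y generalizing w w' with
  | nil => simp only [afterRun]; ring
  | cons a y ih =>
    simp only [afterRun]
    rw [ih]
    split_ifs <;> ring

/-- The weights `w` moved up by one. -/
def shiftUp (w : ℕ → ℝ) : ℕ → ℝ
  | 0 => 0
  | r + 1 => w r

lemma afterRun_prepend (b : Bool) (w : ℕ → ℝ) (ν : List Bool → ℝ) (y : List Bool) :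
    afterRun b w (prepend b ν) y = afterRun b (shiftUp w) ν y := by
  induction y generalizing w with
  | nil => simp [afterRun, shiftUp]
  | cons a y ih =>
    rw [afterRun, afterRun, prepend_cons, ih]
    by_cases h : a = b
    · simp only [h, if_true, shiftUp, zero_mul, zero_add]
      rcases y with _ | ⟨c, y⟩ <;> simp [afterRun, shiftUp]
    · simp [h, shiftUp]

lemma afterRun_fairBinom_zero (b : Bool) (ν : List Bool → ℝ) (y : List Bool) :
    afterRun b (fairBinom 0) ν y = ν y := by
  have h : (fun r => fairBinom 0 (r + 1)) = fun _ => (0 : ℝ) := by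
    funext r
    exact fairBinom_eq_zero (by omega)
  have h0 : fairBinom 0 0 = 1 := by simp [fairBinom]
  rcases y with _ | ⟨a, y⟩
  · simp [afterRun, h0]
  · simp [afterRun, h0, h, afterRun_zero]

/-- The divergence from `runLaw` when only the run is left. -/
lemma sum_klTerm_afterRun_nil (b : Bool) (w : ℕ → ℝ) (N r : ℕ) (ν : List Bool → ℝ)
    (h0 : ν [] = 1) (hν : ∀ a y, ν (a :: y) = 0) :
    ∑ y ∈ lists N, klTerm (afterRun b w ν y) (runLaw b r y) =
      ∑ j ∈ Finset.range (N + 1), klTerm (w j) (runWeight (r + j)) := by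
  induction N generalizing w r with
  | zero => simp [sum_lists_zero, afterRun, runLaw, h0]
  | succ N ih =>
    rw [sum_lists_succ' N b, Finset.sum_range_succ']
    simp [afterRun, runLaw, h0, hν, ih, add_comm, add_left_comm]

/-- The divergence from `runLaw` when the run is followed by the other bit. -/
lemma sum_klTerm_afterRun_not (b : Bool) (w : ℕ → ℝ) (k N M r : ℕ) (ν : List Bool → ℝ)
    (hw : ∀ j, k < j → w j = 0) (hN : k + M + 1 ≤ N) (hν : ∀ y, M < y.length → ν y = 0) :
    ∑ y ∈ lists N, klTerm (afterRun b w (prepend (!b) ν) y) (runLaw b r y) =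
      ∑ j ∈ Finset.range (k + 1), ∑ y ∈ lists M,
        klTerm (w j * ν y) (runWeight (r + j) * runLaw (!b) 0 y) := by
  induction k generalizing w r N with
  | zero =>
    obtain ⟨N, rfl⟩ : ∃ K, N = K + 1 := ⟨N - 1, by omega⟩
    have hw' : (fun j => w (j + 1)) = fun _ => (0 : ℝ) := by
      funext j
      exact hw _ (by omega)
    rw [sum_lists_succ' N b]
    simp only [afterRun, prepend_nil, prepend_cons, runLaw, hw', afterRun_zero, Bool.eq_not_self,
      Bool.not_eq_self, if_true, if_false, mul_zero, add_zero, klTerm_zero_left,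
      Finset.sum_const_zero, zero_add, Finset.range_one, Finset.sum_singleton]
    refine (Finset.sum_subset (lists_mono (by omega)) fun y _ hy => ?_).symm
    rw [hν y (by simpa [mem_lists] using hy)]
    simp
  | succ k ih =>
    obtain ⟨N, rfl⟩ : ∃ K, N = K + 1 := ⟨N - 1, by omega⟩
    rw [sum_lists_succ' N b, Finset.sum_range_succ']
    simp only [afterRun, prepend_nil, prepend_cons, runLaw, Bool.eq_not_self,
      Bool.not_eq_self, if_true, if_false, mul_zero, add_zero, klTerm_zero_left, zero_add]
    rw [ih (fun j => w (j + 1)) N (r + 1) (fun j hj => hw _ (by omega)) (by omega)]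
    congr 1
    · simp only [add_assoc, add_comm 1]
    · refine (Finset.sum_subset (lists_mono (by omega)) fun y _ hy => ?_).symm
      rw [hν y (by simpa [mem_lists] using hy)]
      simp

/-- The divergence of the output from `runLaw`, when `k` bits that continue the current run have
been sent before `x`, and each of them survives with probability one half. -/
lemma sum_klTerm_law_le {d : ℝ} (h0 : 1 / 2 ≤ d) (h1 : d ≤ 1) (x : List Bool) (b : Bool) (k N : ℕ)
    (hN : k + x.length ≤ N) :
    ∑ y ∈ lists N, klTerm (afterRun b (fairBinom k) (law d x) y) (runLaw b 0 y) ≤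
      Real.log Real.goldenRatio * ((1 - d) * x.length + k / 2 + 1) := by
  have hl : ∀ x y, 0 ≤ law d x y := law_nonneg (by linarith) h1
  have hV : ∀ b k x y, 0 ≤ afterRun b (fairBinom k) (law d x) y := fun b k x =>
    afterRun_nonneg (fairBinom_nonneg k) (hl x)
  induction x generalizing b k N with
  | nil =>
    rw [sum_klTerm_afterRun_nil b _ N 0 _ (by simp [law]) (by simp [law])]
    have h := sum_klTerm_fairBinom_le k
    simp only [List.length_nil, Nat.cast_zero, mul_zero, zero_add, add_zero] at hN ⊢
    rw [← Finset.sum_subset (Finset.range_mono (Nat.succ_le_succ hN))]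
    · exact h
    · intro j _ hj
      rw [fairBinom_eq_zero (by simpa using hj), klTerm_zero_left]
  | cons a x ih =>
    simp only [List.length_cons] at hN ⊢
    push_cast
    by_cases hab : a = b
    · subst hab
      have e : ∀ y, afterRun a (fairBinom k) (law d (a :: x)) y =
          (2 * d - 1) * afterRun a (fairBinom k) (law d x) y +
            2 * (1 - d) * afterRun a (fairBinom (k + 1)) (law d x) y := by
        intro y
        have e1 : fairBinom (k + 1) =
            fun r => 1 / 2 * fairBinom k r + 1 / 2 * shiftUp (fairBinom k) r := by
          funext r
          rcases r with _ | r
          · rw [fairBinom_succ_zero, shiftUp]; ring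
          · rw [fairBinom_succ_succ, shiftUp]; ring
        have e2 : law d (a :: x) = fun y => d * law d x y + (1 - d) * prepend a (law d x) y := rfl
        rw [e1, e2, afterRun_add_left, afterRun_add_right, afterRun_prepend]
        ring
      have i1 := ih a k N (by omega)
      have i2 := ih a (k + 1) N (by omega)
      push_cast at i2
      calc _ ≤ ∑ y ∈ lists N,
            ((2 * d - 1) * klTerm (afterRun a (fairBinom k) (law d x) y) (runLaw a 0 y) +
              2 * (1 - d) * klTerm (afterRun a (fairBinom (k + 1)) (law d x) y) (runLaw a 0 y)) :=
            Finset.sum_le_sum fun y _ => by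
              rw [e y]
              exact klTerm_convex (by linarith) (by linarith) (by ring) (hV _ _ _ _) (hV _ _ _ _)
                (runLaw_pos _ _ _)
        _ ≤ (2 * d - 1) * (Real.log Real.goldenRatio * ((1 - d) * x.length + k / 2 + 1)) +
            2 * (1 - d) * (Real.log Real.goldenRatio *
              ((1 - d) * x.length + (k + 1) / 2 + 1)) := by
            rw [Finset.sum_add_distrib, ← Finset.mul_sum, ← Finset.mul_sum]
            exact add_le_add (mul_le_mul_of_nonneg_left i1 (by linarith))
              (mul_le_mul_of_nonneg_left i2 (by linarith))
        _ = _ := by ring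
    · obtain rfl : a = !b := by cases a <;> cases b <;> simp_all
      have e : ∀ y, afterRun b (fairBinom k) (law d ((!b) :: x)) y =
          d * afterRun b (fairBinom k) (law d x) y +
            (1 - d) * afterRun b (fairBinom k) (prepend (!b) (law d x)) y := fun y =>
        afterRun_add_right _ _ _ _ _ _ _
      have i1 := ih b k N (by omega)
      have i2 := ih (!b) 0 x.length (by omega)
      simp only [afterRun_fairBinom_zero, Nat.cast_zero, zero_div, add_zero] at i2
      have i3 : ∑ y ∈ lists N,
          klTerm (afterRun b (fairBinom k) (prepend (!b) (law d x)) y) (runLaw b 0 y) =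
          ∑ j ∈ Finset.range (k + 1), klTerm (fairBinom k j) (runWeight j) +
            ∑ y ∈ lists x.length, klTerm (law d x y) (runLaw (!b) 0 y) := by
        rw [sum_klTerm_afterRun_not b _ k N x.length 0 _ (fun j => fairBinom_eq_zero) (by omega)
          (fun y => law_eq_zero d)]
        have : ∀ j y, klTerm (fairBinom k j * law d x y)
            (runWeight (0 + j) * runLaw (!b) 0 y) =
            klTerm (fairBinom k j) (runWeight j) * law d x y +
              fairBinom k j * klTerm (law d x y) (runLaw (!b) 0 y) := by
          intro j y
          rw [zero_add, klTerm_mul_mul (fun h => absurd h (runWeight_pos j).ne')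
            (fun h => absurd h (runLaw_pos _ _ y).ne')]
          ring
        simp only [this, Finset.sum_add_distrib, ← Finset.mul_sum, ← Finset.sum_mul,
          sum_law d x le_rfl, sum_fairBinom, mul_one, one_mul]
      have i4 := sum_klTerm_fairBinom_le k
      calc _ ≤ ∑ y ∈ lists N,
            (d * klTerm (afterRun b (fairBinom k) (law d x) y) (runLaw b 0 y) +
              (1 - d) * klTerm (afterRun b (fairBinom k) (prepend (!b) (law d x)) y)
                (runLaw b 0 y)) :=
            Finset.sum_le_sum fun y _ => by
              rw [e y]
              exact klTerm_convex (by linarith) (by linarith) (by ring) (hV _ _ _ _)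
                (afterRun_nonneg (fairBinom_nonneg k) (prepend_nonneg (hl x)) y)
                (runLaw_pos _ _ _)
        _ ≤ d * (Real.log Real.goldenRatio * ((1 - d) * x.length + k / 2 + 1)) +
            (1 - d) * (Real.log Real.goldenRatio * (k / 2 + 1) +
              Real.log Real.goldenRatio * ((1 - d) * x.length + 1)) := by
            rw [Finset.sum_add_distrib, ← Finset.mul_sum, ← Finset.mul_sum, i3]
            exact add_le_add (mul_le_mul_of_nonneg_left i1 (by linarith))
              (mul_le_mul_of_nonneg_left (add_le_add i4 i2) (by linarith))
        _ = _ := by ring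

/-! ### Dual bounds and their consequences -/

/-- For each block length there is a law of the output from which every output law of the channel
diverges by at most `c` bits per input bit, up to a sublinear term. -/
def HasDualBound (d c : ℝ) : Prop :=
  ∃ K : ℝ, ∀ n : ℕ, ∃ Q : List Bool → ℝ, (∀ y, 0 < Q y) ∧ ∑ y ∈ lists n, Q y ≤ 1 ∧
    ∀ x : Fin n → Bool, ∑ y ∈ lists n, klTerm (law d (List.ofFn x) y) (Q y) ≤
      n * (c * Real.log 2) + (K + Real.log (n + 1))

lemma sum_klTerm_const_mul {s : Finset (List Bool)} {a Q : List Bool → ℝ} {t : ℝ} (ht : 0 < t)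
    (hQ : ∀ y, 0 < Q y) (ha : ∑ y ∈ s, a y = 1) :
    ∑ y ∈ s, klTerm (a y) (t * Q y) = ∑ y ∈ s, klTerm (a y) (Q y) - Real.log t := by
  have : ∀ y, klTerm (a y) (t * Q y) = klTerm (a y) (Q y) - a y * Real.log t := by
    intro y
    rcases eq_or_ne (a y) 0 with h | h
    · simp [h]
    · rw [klTerm, klTerm, Real.log_div h (mul_pos ht (hQ y)).ne', Real.log_div h (hQ y).ne',
        Real.log_mul ht.ne' (hQ y).ne']
      ring
  simp only [this, Finset.sum_sub_distrib, ← Finset.sum_mul, ha, one_mul]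

lemma law_le_one {d : ℝ} (h0 : 0 ≤ d) (h1 : d ≤ 1) (x y : List Bool) : law d x y ≤ 1 := by
  rcases lt_or_ge x.length y.length with h | h
  · rw [law_eq_zero d h]
    exact zero_le_one
  · rw [← sum_law d x le_rfl]
    exact Finset.single_le_sum (fun z _ => law_nonneg h0 h1 x z) (mem_lists.2 h)

lemma hasDualBound_one {d : ℝ} (h0 : 0 ≤ d) (h1 : d ≤ 1) : HasDualBound d 1 := by
  refine ⟨Real.log 2, fun n => ⟨fun _ => (2 ^ (n + 1))⁻¹ * 1, fun _ => by positivity, ?_,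
    fun x => ?_⟩⟩
  · have h : ((lists n).card : ℝ) ≤ 2 ^ (n + 1) := by exact_mod_cast card_lists_le n
    rw [Finset.sum_const, nsmul_eq_mul, mul_one, ← div_eq_mul_inv]
    exact div_le_one_of_le₀ h (by positivity)
  · rw [sum_klTerm_const_mul (Q := fun _ => 1) (by positivity) (fun _ => one_pos)
      (sum_law d _ (by simp)), Real.log_inv, Real.log_pow]
    have h2 : ∑ y ∈ lists n, klTerm (law d (List.ofFn x) y) 1 ≤ 0 :=
      Finset.sum_nonpos fun y _ => by
        rw [klTerm, div_one]
        exact Real.mul_log_nonpos (law_nonneg h0 h1 _ _) (law_le_one h0 h1 _ _)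
    have h3 : 0 ≤ Real.log ((n : ℝ) + 1) := Real.log_nonneg (by simp)
    push_cast
    linarith

lemma hasDualBound_goldenRatio {d : ℝ} (h0 : 1 / 2 ≤ d) (h1 : d ≤ 1) :
    HasDualBound d ((1 - d) * Real.logb 2 Real.goldenRatio) := by
  refine ⟨Real.log Real.goldenRatio, fun n => ⟨fun y => ((n : ℝ) + 1)⁻¹ * runLaw false 0 y,
    fun y => mul_pos (by positivity) (runLaw_pos _ _ _), ?_, fun x => ?_⟩⟩
  · rw [← Finset.mul_sum, inv_mul_le_one₀ (by positivity)]
    exact (sum_runLaw_le n false 0).trans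
      (mul_le_of_le_one_right (by positivity) (sum_runWeight_le _))
  · rw [sum_klTerm_const_mul (by positivity) (runLaw_pos _ _) (sum_law d _ (by simp)),
      Real.log_inv]
    have h := sum_klTerm_law_le h0 h1 (List.ofFn x) false 0 n (by simp)
    simp only [afterRun_fairBinom_zero, List.length_ofFn, Nat.cast_zero, zero_div, add_zero] at h
    have h2 : Real.logb 2 Real.goldenRatio * Real.log 2 = Real.log Real.goldenRatio :=
      div_mul_cancel₀ _ (Real.log_pos one_lt_two).ne'
    rw [mul_assoc (1 - d), h2]
    linarith

lemma tendsto_dualBound_div (c K : ℝ) :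
    Tendsto (fun n : ℕ => ((n : ℝ) * c + (K + Real.log (n + 1))) / n) atTop (𝓝 c) := by
  have hlog : Tendsto (fun n : ℕ => Real.log ((n : ℝ) + 1) / n) atTop (𝓝 0) := by
    have h1 : Tendsto (fun n : ℕ => Real.log ((n : ℝ) + 1) / ((n : ℝ) + 1)) atTop (𝓝 0) := by
      have h := Real.isLittleO_log_id_atTop.tendsto_div_nhds_zero.comp
        (tendsto_atTop_add_const_right _ (1 : ℝ) tendsto_natCast_atTop_atTop)
      exact h
    have h2 : Tendsto (fun n : ℕ => 1 + 1 / (n : ℝ)) atTop (𝓝 (1 + 0)) :=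
      tendsto_const_nhds.add tendsto_one_div_atTop_nhds_zero_nat
    have h3 := h1.mul h2
    rw [zero_mul] at h3
    refine h3.congr' ?_
    filter_upwards [eventually_gt_atTop 0] with n hn
    have : (0 : ℝ) < n := by exact_mod_cast hn
    field_simp
  have h := ((tendsto_const_nhds (x := c)).add
    (tendsto_const_nhds.div_atTop tendsto_natCast_atTop_atTop : Tendsto (fun n : ℕ => K / n) _ _)).add
    hlog
  simp only [add_zero] at h
  refine h.congr' ?_
  filter_upwards [eventually_gt_atTop 0] with n hn
  have : (n : ℝ) ≠ 0 := by exact_mod_cast hn.ne'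
  field_simp
  ring

/-! ### The limit of the normalized mutual information -/

lemma mutualInfo_eq (d : ℝ) {n : ℕ} (P : (Fin n → Bool) → ℝ) :
    mutualInfo d P = info P (fun x y => law d (List.ofFn x) y) (lists n) / Real.log 2 := by
  rw [mutualInfo, info, Finset.sum_div]
  refine Finset.sum_congr rfl fun x _ => ?_
  rw [Finset.sum_subset (outputs_subset_lists n) fun y _ hy => by
    rw [transition_eq_zero d x hy]; simp, Finset.mul_sum, Finset.sum_div]
  refine Finset.sum_congr rfl fun y _ => ?_
  have : outputProb d P y = outLaw P (fun x y => law d (List.ofFn x) y) y :=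
    Finset.sum_congr rfl fun x _ => by rw [transition_eq_law]
  rw [this, transition_eq_law, klTerm, Real.logb]
  ring

variable {d : ℝ}

lemma mutualInfo_nonneg (h0 : 0 ≤ d) (h1 : d ≤ 1) {n : ℕ} {P : (Fin n → Bool) → ℝ}
    (hP : P ∈ stdSimplex ℝ (Fin n → Bool)) : 0 ≤ mutualInfo d P := by
  rw [mutualInfo_eq]
  exact div_nonneg (info_nonneg hP.1 (fun x y => law_nonneg h0 h1 _ _) hP.2
    fun x => sum_law d _ (by simp)) (Real.log_nonneg one_le_two)

lemma mutualInfo_le (h0 : 0 ≤ d) (h1 : d ≤ 1) {n : ℕ} {P : (Fin n → Bool) → ℝ}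
    (hP : P ∈ stdSimplex ℝ (Fin n → Bool)) {Q : List Bool → ℝ} (hQ : ∀ y, 0 < Q y)
    (hQ1 : ∑ y ∈ lists n, Q y ≤ 1) {B : ℝ}
    (hB : ∀ x : Fin n → Bool, ∑ y ∈ lists n, klTerm (law d (List.ofFn x) y) (Q y) ≤ B) :
    mutualInfo d P ≤ B / Real.log 2 := by
  rw [mutualInfo_eq]
  refine div_le_div_of_nonneg_right ?_ (Real.log_nonneg one_le_two)
  refine (info_le (W := fun (x : Fin n → Bool) y => law d (List.ofFn x) y) hP.1
    (fun x y => law_nonneg h0 h1 _ _) hP.2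
    (fun x => sum_law d _ (List.length_ofFn (f := x)).le) Q (fun y _ => (hQ y).le) hQ1
    fun _ _ y _ h => absurd h (hQ y).ne').trans ?_
  refine (Finset.sum_le_sum fun x _ => mul_le_mul_of_nonneg_left (hB x) (hP.1 x)).trans ?_
  rw [← Finset.sum_mul, hP.2, one_mul]

lemma nonempty_mutualInfo_image (n : ℕ) :
    ((fun P => mutualInfo d P) '' stdSimplex ℝ (Fin n → Bool)).Nonempty :=
  Set.Nonempty.image _ ⟨_, single_mem_stdSimplex ℝ fun _ => false⟩

lemma bddAbove_mutualInfo_image (h0 : 0 ≤ d) (h1 : d ≤ 1) (n : ℕ) :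
    BddAbove ((fun P => mutualInfo d P) '' stdSimplex ℝ (Fin n → Bool)) := by
  obtain ⟨K, hK⟩ := hasDualBound_one h0 h1
  obtain ⟨Q, hQ, hQ1, hB⟩ := hK n
  refine ⟨(n * (1 * Real.log 2) + (K + Real.log (n + 1))) / Real.log 2, ?_⟩
  rintro _ ⟨P, hP, rfl⟩
  exact mutualInfo_le h0 h1 hP hQ hQ1 hB

lemma maxMutualInfo_add_le (h0 : 0 ≤ d) (h1 : d ≤ 1) (m n : ℕ) :
    maxMutualInfo d (m + n) ≤ maxMutualInfo d m + maxMutualInfo d n := by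
  refine csSup_le (nonempty_mutualInfo_image _) ?_
  rintro _ ⟨P, hP, rfl⟩
  let e : (Fin m → Bool) × (Fin n → Bool) ≃ (Fin (m + n) → Bool) := Fin.appendEquiv m n
  set P' : (Fin m → Bool) × (Fin n → Bool) → ℝ := fun p => P (e p) with hP'
  have hP0 : ∀ p, 0 ≤ P' p := fun p => hP.1 _
  have hP1 : ∑ p, P' p = 1 := by rw [← hP.2]; exact Equiv.sum_comp e P
  have hW : ∀ (k : ℕ) (x : Fin k → Bool) (y : List Bool), 0 ≤ law d (List.ofFn x) y :=
    fun k x y => law_nonneg h0 h1 _ _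
  have hW1 : ∀ (k : ℕ) (x : Fin k → Bool), ∑ y ∈ lists k, law d (List.ofFn x) y = 1 :=
    fun k x => sum_law d _ (by simp)
  have key := info_prod_le (s := lists m) (s' := lists n) (P := P')
    (fun p : List Bool × List Bool => p.1 ++ p.2) (lists (m + n))
    (fun p hp => by
      simp only [Finset.mem_product, mem_lists] at hp
      simp only [mem_lists, List.length_append]
      omega) hP0 hP1 (hW m) (hW1 m) (hW n) (hW1 n)
  have hlaw : ∀ (a : (Fin m → Bool) × (Fin n → Bool)) (c : List Bool),
      ∑ p ∈ lists m ×ˢ lists n with p.1 ++ p.2 = c,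
        law d (List.ofFn a.1) p.1 * law d (List.ofFn a.2) p.2 = law d (List.ofFn (e a)) c := by
    intro a c
    rw [← law_append d _ _ c (by simp) (by simp), ← List.ofFn_fin_append]
    rfl
  simp only [hlaw] at key
  have h3 : info P' (fun a c => law d (List.ofFn (e a)) c) (lists (m + n)) =
      info P (fun x y => law d (List.ofFn x) y) (lists (m + n)) := by
    have ho : ∀ y, outLaw P' (fun a c => law d (List.ofFn (e a)) c) y =
        outLaw P (fun x y => law d (List.ofFn x) y) y := fun y =>
      Equiv.sum_comp e fun x => P x * law d (List.ofFn x) y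
    simp only [info, ho]
    exact Equiv.sum_comp e fun x => P x * ∑ y ∈ lists (m + n), klTerm (law d (List.ofFn x) y)
      (outLaw P (fun x y => law d (List.ofFn x) y) y)
  have hs₁ : (fun a => ∑ a', P' (a, a')) ∈ stdSimplex ℝ (Fin m → Bool) :=
    ⟨fun a => Finset.sum_nonneg fun a' _ => hP0 _, by rw [← hP1, Fintype.sum_prod_type]⟩
  have hs₂ : (fun a' => ∑ a, P' (a, a')) ∈ stdSimplex ℝ (Fin n → Bool) :=
    ⟨fun a => Finset.sum_nonneg fun a' _ => hP0 _, by rw [← hP1, Fintype.sum_prod_type_right]⟩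
  have i₁ := le_csSup (bddAbove_mutualInfo_image h0 h1 m) ⟨_, hs₁, rfl⟩
  have i₂ := le_csSup (bddAbove_mutualInfo_image h0 h1 n) ⟨_, hs₂, rfl⟩
  refine le_trans ?_ (add_le_add i₁ i₂)
  simp only [mutualInfo_eq]
  rw [← add_div, ← h3]
  exact div_le_div_of_nonneg_right key (Real.log_nonneg one_le_two)

lemma maxMutualInfo_nonneg (h0 : 0 ≤ d) (h1 : d ≤ 1) (n : ℕ) : 0 ≤ maxMutualInfo d n :=
  Real.sSup_nonneg <| by
    rintro _ ⟨P, hP, rfl⟩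
    exact mutualInfo_nonneg h0 h1 hP

lemma tendsto_maxMutualInfo_div (h0 : 0 ≤ d) (h1 : d ≤ 1) :
    Tendsto (fun n : ℕ => maxMutualInfo d n / n) atTop (𝓝 (informationCapacity d)) := by
  have hsub : Subadditive (maxMutualInfo d) := maxMutualInfo_add_le h0 h1
  refine tendsto_nhds_limUnder ⟨_, hsub.tendsto_lim ⟨0, ?_⟩⟩
  rintro _ ⟨n, rfl⟩
  exact div_nonneg (maxMutualInfo_nonneg h0 h1 n) n.cast_nonneg

lemma HasDualBound.informationCapacity_le {c : ℝ} (h : HasDualBound d c) (h0 : 0 ≤ d)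
    (h1 : d ≤ 1) : informationCapacity d ≤ c := by
  obtain ⟨K, hK⟩ := h
  have hlog : 0 < Real.log 2 := Real.log_pos one_lt_two
  have hlim := (tendsto_dualBound_div (c * Real.log 2) K).div_const (Real.log 2)
  rw [mul_div_cancel_right₀ _ hlog.ne'] at hlim
  refine le_of_tendsto_of_tendsto' (tendsto_maxMutualInfo_div h0 h1) hlim fun n => ?_
  rw [div_right_comm]
  refine div_le_div_of_nonneg_right ?_ n.cast_nonneg
  refine csSup_le (nonempty_mutualInfo_image n) ?_
  rintro _ ⟨P, hP, rfl⟩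
  obtain ⟨Q, hQ, hQ1, hB⟩ := hK n
  exact mutualInfo_le h0 h1 hP hQ hQ1 hB

/-! ### The achievable rates -/

/-- Fano's inequality, with the divergence from a fixed output law. -/
lemma success_mul_log_le (h0 : 0 ≤ d) (h1 : d ≤ 1) {n M : ℕ} (hM : 0 < M)
    (enc : Fin M → Fin n → Bool) (dec : List Bool → Fin M) {Q : List Bool → ℝ}
    (hQ : ∀ y, 0 < Q y) (hQ1 : ∑ y ∈ lists n, Q y ≤ 1) {B : ℝ}
    (hB : ∀ x : Fin n → Bool, ∑ y ∈ lists n, klTerm (law d (List.ofFn x) y) (Q y) ≤ B) :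
    (1 - failureProb d enc dec) * Real.log M ≤ B + Real.log 2 := by
  have hM' : (0 : ℝ) < M := by exact_mod_cast hM
  set a : Fin M × List Bool → ℝ := fun p => (M : ℝ)⁻¹ * law d (List.ofFn (enc p.1)) p.2 with ha
  set b : Fin M × List Bool → ℝ := fun p => (M : ℝ)⁻¹ * Q p.2 with hb
  set U : Finset (Fin M × List Bool) := Finset.univ ×ˢ lists n with hU
  have ha0 : ∀ p, 0 ≤ a p := fun p => mul_nonneg (inv_nonneg.2 hM'.le) (law_nonneg h0 h1 _ _)
  have hb0 : ∀ p, 0 < b p := fun p => mul_pos (inv_pos.2 hM') (hQ _)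
  have htot : ∑ p ∈ U, klTerm (a p) (b p) ≤ B := by
    simp only [ha, hb, klTerm_mul_left (inv_pos.2 hM').ne']
    rw [hU, Finset.sum_product]
    simp only [← Finset.mul_sum]
    refine (mul_le_mul_of_nonneg_left (Finset.sum_le_sum fun m _ => hB (enc m))
      (inv_pos.2 hM').le).trans (le_of_eq ?_)
    rw [Finset.sum_const, Finset.card_univ, Fintype.card_fin, nsmul_eq_mul]
    field_simp
  have ha1 : ∑ p ∈ U, a p = 1 := by
    simp only [ha, ← Finset.mul_sum]
    rw [hU, Finset.sum_product]
    simp only [sum_law d _ (List.length_ofFn (f := enc _)).le, Finset.sum_const, Finset.card_univ,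
      Fintype.card_fin, nsmul_eq_mul, mul_one]
    field_simp
  have hfail : failureProb d enc dec = ∑ p ∈ U with ¬ dec p.2 = p.1, a p := by
    rw [Finset.sum_filter, hU, Finset.sum_product, failureProb, div_eq_inv_mul, Finset.mul_sum]
    refine Finset.sum_congr rfl fun m _ => ?_
    have := sum_survivalProb d (enc m) le_rfl fun y => if dec y = m then 0 else 1
    simp only [mul_ite, mul_zero, mul_one] at this
    rw [this, Finset.mul_sum]
    refine Finset.sum_congr rfl fun y _ => ?_
    simp only [ha]
    split_ifs <;> simp_all
  set s := ∑ p ∈ U with dec p.2 = p.1, a p with hs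
  set f := ∑ p ∈ U with ¬ dec p.2 = p.1, a p with hf
  have hsf : s + f = 1 := by rw [← ha1]; exact Finset.sum_filter_add_sum_filter_not _ _ _
  have hs0 : 0 ≤ s := Finset.sum_nonneg fun p _ => ha0 p
  have hf0 : 0 ≤ f := Finset.sum_nonneg fun p _ => ha0 p
  have hbs : ∑ p ∈ U with dec p.2 = p.1, b p ≤ (M : ℝ)⁻¹ := by
    rw [Finset.sum_filter, hU, Finset.sum_product_right]
    simp only [Finset.sum_ite_eq, Finset.mem_univ, if_true, hb, ← Finset.mul_sum]
    exact mul_le_of_le_one_right (inv_pos.2 hM').le hQ1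
  have hbf : ∑ p ∈ U with ¬ dec p.2 = p.1, b p ≤ 1 := by
    refine (Finset.sum_le_sum_of_subset_of_nonneg (Finset.filter_subset _ _)
      fun p _ _ => (hb0 p).le).trans ?_
    rw [hU, Finset.sum_product]
    simp only [hb, ← Finset.mul_sum, Finset.sum_const, Finset.card_univ, Fintype.card_fin,
      nsmul_eq_mul]
    rwa [inv_mul_cancel_left₀ hM'.ne']
  have part : ∀ (V : Finset (Fin M × List Bool)) (t : ℝ), ∑ p ∈ V, b p ≤ t →
      klTerm (∑ p ∈ V, a p) t ≤ ∑ p ∈ V, klTerm (a p) (b p) := by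
    intro V t ht
    rcases V.eq_empty_or_nonempty with rfl | hV
    · simp
    · exact (klTerm_anti_right (Finset.sum_nonneg fun p _ => ha0 p)
        (Finset.sum_pos (fun p _ => hb0 p) hV) ht).trans (klTerm_sum_le V a b (fun p _ => ha0 p)
        (fun p _ => (hb0 p).le) fun p _ h => absurd h (hb0 p).ne')
  have p1 := part _ _ hbs
  have p2 := part _ _ hbf
  have p3 := Finset.sum_filter_add_sum_filter_not U (fun p => dec p.2 = p.1)
    fun p => klTerm (a p) (b p)
  have e1 : klTerm s (M : ℝ)⁻¹ = s * Real.log s + s * Real.log M := by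
    rw [klTerm]
    rcases hs0.eq_or_lt with h | h
    · simp [← h]
    · rw [div_inv_eq_mul, Real.log_mul h.ne' hM'.ne', mul_add]
  have e2 : klTerm f 1 = f * Real.log f := by rw [klTerm, div_one]
  have e3 : Real.binEntropy s = -(s * Real.log s) - f * Real.log f := by
    rw [Real.binEntropy, Real.log_inv, Real.log_inv, ← eq_sub_of_add_eq' hsf]
    ring
  have e4 : Real.binEntropy s ≤ Real.log 2 := Real.binEntropy_le_log_two
  have e5 : 1 - failureProb d enc dec = s := by rw [hfail]; linarith
  rw [e5]
  linarith

lemma isAchievableRate_zero (d : ℝ) : IsAchievableRate d 0 := fun ε hε =>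
  .of_forall fun n => ⟨1, fun _ _ => false, fun _ => 0, by simp, by
    simp [failureProb, Subsingleton.elim _ (0 : Fin 1), hε.le]⟩

lemma HasDualBound.le_of_isAchievableRate {c : ℝ} (h : HasDualBound d c) (h0 : 0 ≤ d)
    (h1 : d ≤ 1) (hc : 0 ≤ c) {R : ℝ} (hR : IsAchievableRate d R) : R ≤ c := by
  rcases le_or_gt R 0 with hR0 | hR0
  · exact hR0.trans hc
  obtain ⟨K, hK⟩ := h
  have hlog : 0 < Real.log 2 := Real.log_pos one_lt_two
  have key : ∀ ε > 0, ε < 1 → (1 - ε) * (R * Real.log 2) ≤ c * Real.log 2 := by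
    intro ε hε hε1
    refine ge_of_tendsto (tendsto_dualBound_div (c * Real.log 2) (K + Real.log 2)) ?_
    filter_upwards [hR ε hε, eventually_gt_atTop 0] with n ⟨M, enc, dec, hM, hfail⟩ hn
    have hn' : (0 : ℝ) < n := by exact_mod_cast hn
    have hM0 : (0 : ℝ) < M := lt_of_lt_of_le (by positivity) hM
    obtain ⟨Q, hQ, hQ1, hB⟩ := hK n
    have hF := success_mul_log_le h0 h1 (by exact_mod_cast hM0) enc dec hQ hQ1 hB
    have hlM : n * R * Real.log 2 ≤ Real.log M := by
      rw [← Real.log_rpow two_pos]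
      exact Real.log_le_log (by positivity) hM
    have h2 : 0 ≤ n * R * Real.log 2 := by positivity
    rw [le_div_iff₀ hn']
    have h3 : (1 - ε) * (n * R * Real.log 2) ≤ (1 - failureProb d enc dec) * Real.log M :=
      mul_le_mul (by linarith) hlM h2 (by linarith)
    linarith
  have hlim : Tendsto (fun ε : ℝ => (1 - ε) * (R * Real.log 2)) (𝓝[>] 0)
      (𝓝 ((1 - 0) * (R * Real.log 2))) :=
    ((continuous_const.sub continuous_id).mul continuous_const).continuousWithinAt.tendsto
  have h := le_of_tendsto hlim (by
    filter_upwards [Ioo_mem_nhdsGT one_pos] with ε hε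
    exact key ε hε.1 hε.2)
  rw [sub_zero, one_mul] at h
  exact le_of_mul_le_mul_right h hlog

lemma isLUB_capacity (h0 : 0 ≤ d) (h1 : d ≤ 1) :
    IsLUB {R : ℝ | IsAchievableRate d R} (capacity d) :=
  isLUB_csSup ⟨0, isAchievableRate_zero d⟩
    ⟨1, fun _ hR => (hasDualBound_one h0 h1).le_of_isAchievableRate h0 h1 zero_le_one hR⟩

lemma HasDualBound.capacity_le {c : ℝ} (h : HasDualBound d c) (h0 : 0 ≤ d) (h1 : d ≤ 1)
    (hc : 0 ≤ c) : capacity d ≤ c :=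
  (isLUB_capacity h0 h1).2 fun _ hR => h.le_of_isAchievableRate h0 h1 hc hR

/-- A convex function on `[0, 1/2]` is at most the chord through bounds at the end points. -/
lemma le_chord_of_convexOn {F : ℝ → ℝ} (hF : ConvexOn ℝ (Set.Icc (0 : ℝ) (1 / 2)) F)
    (hF0 : F 0 ≤ 1) (hF1 : F (1 / 2) ≤ (1 - 1 / 2) * Real.logb 2 Real.goldenRatio)
    (hd : d ∈ Set.Ico (0 : ℝ) (1 / 2)) : F d ≤ 1 - d * Real.logb 2 (4 / Real.goldenRatio) := by
  have h := hF.2 (Set.left_mem_Icc.2 (by norm_num)) (Set.right_mem_Icc.2 (by norm_num))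
    (by linarith [hd.2] : 0 ≤ 1 - 2 * d) (by linarith [hd.1] : 0 ≤ 2 * d) (by ring)
  simp only [smul_eq_mul, mul_zero, zero_add] at h
  rw [show 2 * d * (1 / 2) = d by ring] at h
  have h4 : Real.logb 2 4 = 2 := by
    rw [show (4 : ℝ) = 2 ^ (2 : ℕ) by norm_num, Real.logb_pow, Real.logb_self_eq_one one_lt_two]
    norm_num
  rw [Real.logb_div (by norm_num) Real.goldenRatio_pos.ne', h4]
  have i1 := mul_le_mul_of_nonneg_left hF0 (by linarith [hd.2] : 0 ≤ 1 - 2 * d)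
  have i2 := mul_le_mul_of_nonneg_left hF1 (by linarith [hd.1] : 0 ≤ 2 * d)
  linarith

end DeletionChannel

end

theorem mainTheorem1 :
    -- both expressions for the capacity are well defined
    (∀ d ∈ Set.Icc (0 : ℝ) 1,
      IsLUB {R : ℝ | DeletionChannel.IsAchievableRate d R} (DeletionChannel.capacity d)) ∧
    (∀ d ∈ Set.Icc (0 : ℝ) 1,
      Tendsto (fun n : ℕ => DeletionChannel.maxMutualInfo d n / n) atTop
        (𝓝 (DeletionChannel.informationCapacity d))) ∧
    -- the bounds for the largest achievable rate
    (∀ d ∈ Set.Icc (1 / 2 : ℝ) 1,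
      DeletionChannel.capacity d ≤ (1 - d) * Real.logb 2 Real.goldenRatio) ∧
    (ConvexOn ℝ (Set.Icc (0 : ℝ) (1 / 2)) DeletionChannel.capacity →
      ∀ d ∈ Set.Ico (0 : ℝ) (1 / 2),
        DeletionChannel.capacity d ≤ 1 - d * Real.logb 2 (4 / Real.goldenRatio)) ∧
    -- the bounds for the limit of the normalized mutual information
    (∀ d ∈ Set.Icc (1 / 2 : ℝ) 1,
      DeletionChannel.informationCapacity d ≤ (1 - d) * Real.logb 2 Real.goldenRatio) ∧
    (ConvexOn ℝ (Set.Icc (0 : ℝ) (1 / 2)) DeletionChannel.informationCapacity →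
      ∀ d ∈ Set.Ico (0 : ℝ) (1 / 2),
        DeletionChannel.informationCapacity d ≤ 1 - d * Real.logb 2 (4 / Real.goldenRatio)) := by
  have half : (1 / 2 : ℝ) ∈ Set.Icc (1 / 2 : ℝ) 1 := by constructor <;> norm_num
  have cap : ∀ d ∈ Set.Icc (1 / 2 : ℝ) 1,
      DeletionChannel.capacity d ≤ (1 - d) * Real.logb 2 Real.goldenRatio := fun d hd =>
    (DeletionChannel.hasDualBound_goldenRatio hd.1 hd.2).capacity_le
      (le_trans (by norm_num) hd.1) hd.2 (mul_nonneg (sub_nonneg.2 hd.2)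
        (Real.logb_nonneg one_lt_two Real.one_lt_goldenRatio.le))
  have icap : ∀ d ∈ Set.Icc (1 / 2 : ℝ) 1,
      DeletionChannel.informationCapacity d ≤ (1 - d) * Real.logb 2 Real.goldenRatio := fun d hd =>
    (DeletionChannel.hasDualBound_goldenRatio hd.1 hd.2).informationCapacity_le
      (le_trans (by norm_num) hd.1) hd.2
  have one := DeletionChannel.hasDualBound_one le_rfl zero_le_one
  exact ⟨fun d hd => DeletionChannel.isLUB_capacity hd.1 hd.2,
    fun d hd => DeletionChannel.tendsto_maxMutualInfo_div hd.1 hd.2, cap,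
    fun hconv d hd => DeletionChannel.le_chord_of_convexOn hconv
      (one.capacity_le le_rfl zero_le_one zero_le_one) (cap _ half) hd, icap,
    fun hconv d hd => DeletionChannel.le_chord_of_convexOn hconv
      (one.informationCapacity_le le_rfl zero_le_one) (icap _ half) hd⟩
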